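/- Let $\mathbb F_q$ be a finite field with $q$ elements and let $0<\varepsilon<1$, $0<R<1$ be fixed. For a linear code $C\subseteq\mathbb F_q^n$, let $P_{\mathrm{ud}}(C,\varepsilon)$ be the probability that a uniformly random codeword of $C$, sent over the $q$-ary erasure channel (each symbol is erased independently with probability $\varepsilon$ and is otherwise received correctly), is not recovered by unambiguous decoding, that is, by the decoder which outputs the codeword agreeing with all unerased symbols if there is exactly one such codeword and declares failure otherwise. For $H\in\mathbb F_q^{m\times n}$ let $C_H=\{\mathbf x\in\mathbb F_q^n : H\mathbf x^{t}=\mathbf 0\}$, and let $\sigma^2_{\mathrm{ud}}(\mathcal R_{m,n},\varepsilon)$ be the variance of $P_{\mathrm{ud}}(C_H,\varepsilon)$ when $H$ is uniformly distributed over the set $\mathcal R_{m,n}$ of all $m\times n$ matrices over $\mathbb F_q$. Let $m=m_n$ be $(1-R)n$, rounded in any way to a non-negative integer if it is not an integer (that is, $|m_n-(1-R)n|<1$ for all $n$). Then $\sigma^2_{\mathrm{ud}}(\mathcal R_{m_n,n},\varepsilon)>0$ for all sufficiently large $n$, the limit $$S_{\mathrm{ud}}(\varepsilon):=-\lim_{n\to\infty}\frac1n\log_q\sigma^2_{\mathrm{ud}}(\mathcal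 R_{m_n,n},\varepsilon)$$ exists, and $$S_{\mathrm{ud}}(\varepsilon)=\begin{cases}1-R-\log_q[1+(q-1)\varepsilon^2] & \text{if } 0<R\le\frac{1-\varepsilon}{1+(q-1)\varepsilon^2},\\[1ex](1-R)\log_q\left(\frac{\kappa_0}{\varepsilon^2}\right)+R\log_q\left(\frac{2R-1+\kappa_0}{(1-\varepsilon)^2}\right) & \text{if } \frac{1-\varepsilon}{1+(q-1)\varepsilon^2}<R<1,\end{cases}$$ where $$\kappa_0=1-R-\frac{\sqrt{4R(1-R)(q-1)+1}-1}{2(q-1)}.$$ -/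

import Mathlib

namespace ErasureChannel

noncomputable section

/-- The parity-check code `C_H = {x ∈ F^n : H xᵗ = 0}` of a matrix `H`. -/
def parityCheckCode {F : Type*} [Field F] {m n : ℕ} (H : Matrix (Fin m) (Fin n) F) :
    Submodule F (Fin n → F) :=
  LinearMap.ker H.mulVecLin

/-- The word received when `x` is sent and exactly the positions in `E` are erased
(`none` is the erasure symbol). -/
def received {F : Type*} {n : ℕ} (x : Fin n → F) (E : Finset (Fin n)) : Fin n → Option F :=
  fun i => if i ∈ E then none else some (x i)

/-- The codewords of `C` that agree with the received word `y` in every position that was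
not erased. -/
def compatible {F : Type*} [Field F] {n : ℕ} (C : Submodule F (Fin n → F))
    (y : Fin n → Option F) : Set (Fin n → F) :=
  {x | x ∈ C ∧ ∀ i a, y i = some a → x i = a}

open Classical in
/-- The unambiguous decoder of `C`: it outputs the compatible codeword if there is exactly one,
and declares a failure (`none`) otherwise. -/
def unambiguousDecoder {F : Type*} [Field F] {n : ℕ} (C : Submodule F (Fin n → F))
    (y : Fin n → Option F) : Option (Fin n → F) :=
  if h : ∃! x, x ∈ compatible C y then some h.choose else none

/-- The probability that the set of erased positions is `E`, when each of the `n` transmitted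
symbols is erased independently with probability `ε`. -/
def erasureProb {n : ℕ} (ε : ℝ) (E : Finset (Fin n)) : ℝ :=
  ε ^ E.card * (1 - ε) ^ (n - E.card)

open Classical in
/-- The unsuccessful decoding probability `P_ud(C, ε)` under unambiguous decoding: the
probability that a uniformly distributed codeword of `C`, sent over the erasure channel with
erasure probability `ε`, is not recovered by the unambiguous decoder of `C`. -/
def Pud {F : Type*} [Field F] [Fintype F] {n : ℕ} (C : Submodule F (Fin n → F)) (ε : ℝ) : ℝ :=
  (∑ x : Fin n → F with x ∈ C, ∑ E : Finset (Fin n),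
    if unambiguousDecoder C (received x E) ≠ some x then erasureProb ε E else 0) /
    (Nat.card C : ℝ)

/-- The mean of `X` over the ensemble of all `m × n` matrices over `F` with uniform
probability. -/
def ensembleMean (F : Type*) [Field F] [Fintype F] (m n : ℕ)
    (X : Matrix (Fin m) (Fin n) F → ℝ) : ℝ :=
  open Classical in
  (∑ H : Matrix (Fin m) (Fin n) F, X H) / (Fintype.card (Matrix (Fin m) (Fin n) F) : ℝ)

/-- The variance of `P_ud(C_H, ε)` when `H` is uniformly distributed over all `m × n` matrices
over `F`. -/
def varianceUd (F : Type*) [Field F] [Fintype F] (m n : ℕ) (ε : ℝ) : ℝ :=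
  ensembleMean F m n fun H =>
    (Pud (parityCheckCode H) ε - ensembleMean F m n fun H' => Pud (parityCheckCode H') ε) ^ 2

/-- The constant `κ₀(R)`. -/
def kappaZero (q R : ℝ) : ℝ :=
  1 - R - (√(4 * R * (1 - R) * (q - 1) + 1) - 1) / (2 * (q - 1))

end

end ErasureChannel

/-! Decoding fails exactly when the columns of `H` at the erased positions are linearly dependent.
Hence `Pud` is a weighted sum of dependence indicators over erasure patterns, and the variance is a
double sum of covariances over pairs `A`, `B` (`varianceUd_eq_sum`). The covariance has a closed
form: it vanishes when `A` or `B` has more than `m` elements, and otherwise has order `q ^ (|A ∩ B|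
- m)` up to boundary cases (`indepCov_le`, `le_indepCov`).

It remains to find the growth rate of the sum of the weights times `q ^ |A ∩ B|` over pairs of sizes
at most `m`. Without the size constraint the sum factorizes over positions into an `n`-th power. The
constraint is handled by a tilt `t ^ (|A| + |B|)` with `t ≤ 1`: a Chernoff bound gives the upper
estimate (`varianceUd_le`), and Chebyshev's inequality for the tilted measure gives the lower one
(`le_varianceUd`). The exponents agree when `t = 1` with tilted erasure rate at most `1 - R`, or
when the tilted rate equals `1 - R`. These are the two cases of the formula, and `κ₀` comes from
solving the second condition (`exists_optimal_tilt`). -/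

namespace ErasureChannel

/-! ### Linear independence of random vectors -/

open Function in
theorem sum_sum_update {ι V : Type*} [Fintype ι] [DecidableEq ι] [Fintype V] (a : ι)
    (g : (ι → V) → ℝ) :
    ∑ c : ι → V, ∑ v, g (update c a v) = Fintype.card V * ∑ c : ι → V, g c := by
  -- Exchanging the entry at `a` with the spare value `v` permutes the pairs, so resampling one
  -- coordinate preserves the uniform measure.
  have hinv : Involutive (fun p : (ι → V) × V => (update p.1 a p.2, p.1 a)) := by
    rintro ⟨c, v⟩
    simp
  calc ∑ c : ι → V, ∑ v, g (update c a v)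
      = ∑ p : (ι → V) × V, g (update p.1 a p.2) := (Fintype.sum_prod_type' _).symm
    _ = ∑ p : (ι → V) × V, g p.1 :=
        Fintype.sum_equiv hinv.toPerm _ _ fun p => rfl
    _ = _ := by
        rw [Fintype.sum_prod_type]
        simp [Finset.mul_sum]

open Classical in
/-- The indicator of linear independence of the subfamily of `c` indexed by `A`. -/
noncomputable def indepInd (F : Type*) [Field F] {V : Type*} [AddCommGroup V] [Module F V]
    {ι : Type*} (A : Finset ι) (c : ι → V) : ℝ :=
  if LinearIndepOn F c (A : Set ι) then 1 else 0

section Independence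

variable {F : Type*} [Field F] {V : Type*} [AddCommGroup V] [Module F V]
  {ι : Type*} [DecidableEq ι]

theorem indepInd_update {A : Finset ι} {a : ι} (ha : a ∉ A) (c : ι → V) (v : V) :
    indepInd F A (Function.update c a v) = indepInd F A c := by
  have h : LinearIndepOn F (Function.update c a v) (A : Set ι) ↔
      LinearIndepOn F c (A : Set ι) := by
    refine linearIndepOn_congr fun i hi => ?_
    rw [Function.update_of_ne]
    rintro rfl
    exact ha hi
  classical
  exact if_congr h rfl rfl

variable [Fintype F] [Fintype V]

/-- The new vector must avoid the span of the old ones, which has `q ^ |A|` elements when these are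
independent. -/
theorem sum_indepInd_insert_update {A : Finset ι} {a : ι} (ha : a ∉ A) (c : ι → V) :
    ∑ v, indepInd F (insert a A) (Function.update c a v) =
      (Fintype.card V - (Fintype.card F : ℝ) ^ A.card) * indepInd F A c := by
  classical
  have hstep : ∀ v, indepInd F (insert a A) (Function.update c a v) =
      indepInd F A c * (1 - if v ∈ Submodule.span F (c '' (A : Set ι)) then 1 else 0) := by
    intro v
    have himg : Function.update c a v '' (A : Set ι) = c '' (A : Set ι) := by
      refine Set.image_congr fun i hi => ?_
      rw [Function.update_of_ne]
      rintro rfl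
      exact ha hi
    rw [← indepInd_update ha c v]
    unfold indepInd
    rw [Finset.coe_insert, linearIndepOn_insert (by simpa using ha), himg, Function.update_self]
    split_ifs <;> simp_all
  simp_rw [hstep]
  rw [← Finset.mul_sum, mul_comm]
  by_cases hA : LinearIndepOn F c (A : Set ι)
  · congr 1
    rw [Finset.sum_sub_distrib]
    simp only [Finset.sum_const, Finset.card_univ, nsmul_eq_mul, mul_one, Finset.sum_boole]
    have hcard : Fintype.card (Submodule.span F (c '' (A : Set ι))) =
        Fintype.card F ^ A.card := by
      rw [Module.card_eq_pow_finrank (K := F), Set.image_eq_range]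
      have := finrank_span_eq_card hA.linearIndependent
      simp only [Finset.coe_sort_coe, Fintype.card_coe] at this
      rw [← this]
      rfl
    rw [← Fintype.card_subtype]
    have h2 : Fintype.card {x // x ∈ Submodule.span F (c '' (A : Set ι))} =
      Fintype.card F ^ A.card := hcard
    rw [h2]
    push_cast
    rfl
  · simp [indepInd, hA]

variable [Fintype ι]

theorem card_mul_sum_indepInd_insert {A : Finset ι} {a : ι} (ha : a ∉ A) (S : (ι → V) → ℝ)
    (hS : ∀ c v, S (Function.update c a v) = S c) :
    Fintype.card V * ∑ c : ι → V, indepInd F (insert a A) c * S c =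
      (Fintype.card V - (Fintype.card F : ℝ) ^ A.card) *
        ∑ c : ι → V, indepInd F A c * S c := by
  rw [← sum_sum_update a, Finset.mul_sum]
  refine Finset.sum_congr rfl fun c _ => ?_
  simp_rw [hS]
  rw [← Finset.sum_mul, sum_indepInd_insert_update ha, mul_assoc]

/-- The vectors indexed by `D` are added one at a time. The weight `S` ignores them, which later
allows `S` to be the indicator for another set. -/
theorem sum_indepInd_union (A D : Finset ι) (hAD : Disjoint A D) (S : (ι → V) → ℝ)
    (hS : ∀ a ∈ D, ∀ c v, S (Function.update c a v) = S c) :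
    ∑ c : ι → V, indepInd F (A ∪ D) c * S c =
      (∏ l ∈ Finset.Ico A.card (A ∪ D).card,
        (1 - (Fintype.card F : ℝ) ^ l / Fintype.card V)) *
        ∑ c : ι → V, indepInd F A c * S c := by
  induction D using Finset.induction_on with
  | empty => simp
  | insert a D haD ih =>
    rw [Finset.disjoint_insert_right] at hAD
    have ha : a ∉ A ∪ D := by simp [hAD.1, haD]
    have hV : (Fintype.card V : ℝ) ≠ 0 := by
      exact_mod_cast Fintype.card_ne_zero
    have h := card_mul_sum_indepInd_insert (F := F) ha S (hS a (by simp))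
    rw [ih hAD.2 fun b hb => hS b (by simp [hb])] at h
    rw [Finset.union_insert, Finset.card_insert_of_notMem ha, Finset.prod_Ico_succ_top
      (Finset.card_le_card Finset.subset_union_left)]
    refine mul_left_cancel₀ hV ?_
    rw [h]
    field_simp

/-- The probability that `i` uniform vectors in a space of size `Q` over a field of size `q` are
linearly independent. -/
noncomputable def indepProb (q Q : ℝ) (i : ℕ) : ℝ :=
  ∏ l ∈ Finset.range i, (1 - q ^ l / Q)

theorem sum_indepInd (A : Finset ι) :
    ∑ c : ι → V, indepInd F A c =
      indepProb (Fintype.card F) (Fintype.card V) A.card * Fintype.card (ι → V) := by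
  have h := sum_indepInd_union (F := F) (V := V) ∅ A (Finset.disjoint_empty_left A)
    (fun _ => 1) (fun _ _ _ _ => rfl)
  have h0 : ∀ c : ι → V, indepInd F (∅ : Finset ι) c = 1 := fun c => by
    simp [indepInd, linearIndepOn_empty]
  simp only [Finset.empty_union, mul_one, h0, Finset.card_empty, Finset.sum_const,
    Finset.card_univ, nsmul_eq_mul, ← Finset.range_eq_Ico] at h
  exact h

theorem sum_indepInd_mul_indepInd (A B : Finset ι) :
    ∑ c : ι → V, indepInd F A c * indepInd F B c =
      (∏ l ∈ Finset.Ico (A ∩ B).card A.card,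
        (1 - (Fintype.card F : ℝ) ^ l / Fintype.card V)) *
      indepProb (Fintype.card F) (Fintype.card V) B.card * Fintype.card (ι → V) := by
  -- Given independence on `B`, hence on `A ∩ B`, only the vectors of `A \ B` are still free.
  have h := sum_indepInd_union (F := F) (V := V) (A ∩ B) (A \ B)
    (Finset.disjoint_left.2 fun x hx hx' => by simp_all) (indepInd F B)
    (fun a ha c v => indepInd_update (by simp_all) c v)
  have hAB : A ∩ B ∪ A \ B = A := by
    ext x
    simp only [Finset.mem_union, Finset.mem_inter, Finset.mem_sdiff]
    tauto
  rw [hAB] at h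
  rw [h, mul_assoc, ← sum_indepInd]
  congr 1
  refine Finset.sum_congr rfl fun c _ => ?_
  by_cases hB : LinearIndepOn F c (B : Set ι)
  · have : LinearIndepOn F c ((A ∩ B : Finset ι) : Set ι) :=
      hB.mono (by simp)
    unfold indepInd
    rw [if_pos hB, if_pos this, one_mul]
  · simp [indepInd, hB]

theorem sum_sub_mul_sub_indepInd (A B : Finset ι) :
    ∑ c : ι → V,
      (indepInd F A c - indepProb (Fintype.card F) (Fintype.card V) A.card) *
        (indepInd F B c - indepProb (Fintype.card F) (Fintype.card V) B.card) =
      (∏ l ∈ Finset.Ico (A ∩ B).card A.card,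
        (1 - (Fintype.card F : ℝ) ^ l / Fintype.card V)) *
      indepProb (Fintype.card F) (Fintype.card V) B.card *
      (1 - indepProb (Fintype.card F) (Fintype.card V) (A ∩ B).card) *
        Fintype.card (ι → V) := by
  have hprod : indepProb (Fintype.card F) (Fintype.card V) A.card =
      indepProb (Fintype.card F) (Fintype.card V) (A ∩ B).card *
        ∏ l ∈ Finset.Ico (A ∩ B).card A.card,
          (1 - (Fintype.card F : ℝ) ^ l / Fintype.card V) :=
    (Finset.prod_range_mul_prod_Ico _ (Finset.card_le_card Finset.inter_subset_left)).symm
  simp only [sub_mul, mul_sub, Finset.sum_sub_distrib, ← Finset.mul_sum, ← Finset.sum_mul,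
    sum_indepInd, sum_indepInd_mul_indepInd, Finset.sum_const, Finset.card_univ, nsmul_eq_mul]
  rw [hprod]
  ring

end Independence

/-! ### Decoding failure as linear dependence of columns -/

section Decoding

variable {F : Type*} [Field F] {n : ℕ}

theorem mem_compatible_received (C : Submodule F (Fin n → F)) (x y : Fin n → F)
    (E : Finset (Fin n)) :
    y ∈ compatible C (received x E) ↔ y ∈ C ∧ ∀ i ∉ E, y i = x i := by
  unfold compatible received
  simp only [Set.mem_ofPred_eq]
  refine and_congr_right fun _ => ⟨fun h i hi => h i _ (by simp [hi]), fun h i a hia => ?_⟩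
  by_cases hi : i ∈ E
  · simp [hi] at hia
  · simp only [hi, if_false, Option.some.injEq] at hia
    rw [h i hi, hia]

/-- Two compatible codewords differ by a codeword supported on `E`; success therefore does not
depend on the word sent, and averaging over codewords is trivial. -/
theorem unambiguousDecoder_received_eq_some (C : Submodule F (Fin n → F)) {x : Fin n → F}
    (hx : x ∈ C) (E : Finset (Fin n)) :
    unambiguousDecoder C (received x E) = some x ↔
      ∀ z ∈ C, (∀ i ∉ E, z i = 0) → z = 0 := by
  have hxx : x ∈ compatible C (received x E) :=
    (mem_compatible_received C x x E).2 ⟨hx, fun _ _ => rfl⟩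
  unfold unambiguousDecoder
  constructor
  · intro h z hz hzE
    split_ifs at h with hu
    have hxz : x + z ∈ compatible C (received x E) :=
      (mem_compatible_received C x _ E).2 ⟨C.add_mem hx hz, fun i hi => by simp [hzE i hi]⟩
    simpa using hu.unique hxz hxx
  · intro h
    have hu : ∃! y, y ∈ compatible C (received x E) := by
      refine ⟨x, hxx, fun y hy => ?_⟩
      replace hy := (mem_compatible_received C x y E).1 hy
      exact sub_eq_zero.1 (h _ (C.sub_mem hy.1 hx) fun i hi => by simp [hy.2 i hi])
    rw [dif_pos hu]
    exact congrArg some (hu.unique hu.choose_spec.1 hxx)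

theorem forall_mem_parityCheckCode_iff {m : ℕ} (H : Matrix (Fin m) (Fin n) F)
    (E : Finset (Fin n)) :
    (∀ z ∈ parityCheckCode H, (∀ i ∉ E, z i = 0) → z = 0) ↔
      LinearIndepOn F H.col (E : Set (Fin n)) := by
  rw [linearIndepOn_finset_iff]
  have hmul : ∀ z : Fin n → F, H.mulVec z = ∑ i, z i • H.col i := by
    intro z
    ext j
    simp [Matrix.mulVec, dotProduct, mul_comm]
  constructor
  · intro h g hg i hi
    have h0 := h (fun i => if i ∈ E then g i else 0) (by
      simp only [parityCheckCode, LinearMap.mem_ker, Matrix.mulVecLin_apply]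
      rw [hmul]
      simpa [ite_smul, Finset.sum_ite_mem] using hg) (fun i hi => by simp [hi])
    simpa [hi] using congrFun h0 i
  · intro h z hz hzE
    simp only [parityCheckCode, LinearMap.mem_ker, Matrix.mulVecLin_apply] at hz
    rw [hmul] at hz
    ext i
    by_cases hi : i ∈ E
    · refine h z ?_ i hi
      rw [← hz]
      exact Finset.sum_subset (Finset.subset_univ _) fun i _ hi => by simp [hzE i hi]
    · exact hzE i hi

theorem Pud_parityCheckCode [Fintype F] {m : ℕ} (H : Matrix (Fin m) (Fin n) F) (ε : ℝ) :
    Pud (parityCheckCode H) ε =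
      ∑ E : Finset (Fin n), erasureProb ε E * (1 - indepInd F E H.col) := by
  classical
  unfold Pud
  have hconst : ∀ x ∈ (Finset.univ.filter fun x : Fin n → F => x ∈ parityCheckCode H),
      (∑ E : Finset (Fin n), if unambiguousDecoder (parityCheckCode H) (received x E) ≠ some x
        then erasureProb ε E else 0) =
      ∑ E : Finset (Fin n), erasureProb ε E * (1 - indepInd F E H.col) := by
    intro x hx
    refine Finset.sum_congr rfl fun E _ => ?_
    rw [Finset.mem_filter] at hx
    have hiff := (unambiguousDecoder_received_eq_some _ hx.2 E).trans
      (forall_mem_parityCheckCode_iff H E)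
    unfold indepInd
    by_cases h : LinearIndepOn F H.col (E : Set (Fin n))
    · simp [hiff.2 h, h]
    · rw [if_pos (fun h' => h (hiff.1 h')), if_neg h]
      simp
  have hcard : (Nat.card (parityCheckCode H) : ℝ) =
      ((Finset.univ.filter fun x : Fin n → F => x ∈ parityCheckCode H).card : ℝ) := by
    rw [← Fintype.card_subtype, Nat.card_eq_fintype_card]
  have hpos : ((Finset.univ.filter fun x : Fin n → F => x ∈ parityCheckCode H).card : ℝ) ≠ 0 := by
    rw [← hcard]
    exact_mod_cast Nat.card_pos.ne'
  have hsum := Finset.sum_congr rfl hconst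
  rw [Finset.sum_const, nsmul_eq_mul] at hsum
  rw [hcard, div_eq_iff hpos, mul_comm _ (Finset.card _ : ℝ), ← hsum]

end Decoding

/-! ### The variance as a sum of covariances -/

/-- The covariance of the events that the columns indexed by `A` and by `B` are linearly
independent. -/
noncomputable def indepCov {ι : Type*} [DecidableEq ι] (q Q : ℝ) (A B : Finset ι) : ℝ :=
  (∏ l ∈ Finset.Ico (A ∩ B).card A.card, (1 - q ^ l / Q)) * indepProb q Q B.card *
    (1 - indepProb q Q (A ∩ B).card)

section Variance

variable {F : Type*} [Field F] [Fintype F] {m n : ℕ}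

theorem ensembleMean_col (g : (Fin n → Fin m → F) → ℝ) :
    (ensembleMean F m n fun H => g H.col) =
      (∑ c : Fin n → Fin m → F, g c) / Fintype.card (Fin n → Fin m → F) := by
  classical
  unfold ensembleMean
  have e : Matrix (Fin m) (Fin n) F ≃ (Fin n → Fin m → F) :=
    Matrix.transposeAddEquiv (Fin m) (Fin n) F |>.toEquiv
  congr 1
  · exact Fintype.sum_equiv
      (Matrix.transposeAddEquiv (Fin m) (Fin n) F |>.toEquiv : _ ≃ (Fin n → Fin m → F)) _ _
      fun H => rfl
  · exact_mod_cast Fintype.card_congr e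

theorem varianceUd_eq_sum (ε : ℝ) :
    varianceUd F m n ε = ∑ A : Finset (Fin n), ∑ B : Finset (Fin n),
      erasureProb ε A * erasureProb ε B *
        indepCov (Fintype.card F) ((Fintype.card F : ℝ) ^ m) A B := by
  classical
  have hQ : (Fintype.card (Fin m → F) : ℝ) = (Fintype.card F : ℝ) ^ m := by simp
  have hN : (Fintype.card (Fin n → Fin m → F) : ℝ) ≠ 0 := by
    exact_mod_cast Fintype.card_ne_zero
  have hmean : (ensembleMean F m n fun H => Pud (parityCheckCode H) ε) =
      ∑ A : Finset (Fin n), erasureProb ε A *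
        (1 - indepProb (Fintype.card F) (Fintype.card (Fin m → F)) A.card) := by
    simp only [Pud_parityCheckCode]
    rw [ensembleMean_col
      (fun c => ∑ A : Finset (Fin n), erasureProb ε A * (1 - indepInd F A c)),
      div_eq_iff hN, Finset.sum_comm, Finset.sum_mul]
    refine Finset.sum_congr rfl fun A _ => ?_
    rw [← Finset.mul_sum, Finset.sum_sub_distrib, sum_indepInd]
    simp only [Finset.sum_const, Finset.card_univ, nsmul_eq_mul]
    ring
  unfold varianceUd
  rw [hmean]
  simp only [Pud_parityCheckCode]
  rw [ensembleMean_col (fun c => (∑ A : Finset (Fin n),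
      erasureProb ε A * (1 - indepInd F A c) - ∑ A : Finset (Fin n), erasureProb ε A *
        (1 - indepProb (Fintype.card F) (Fintype.card (Fin m → F)) A.card)) ^ 2),
      div_eq_iff hN]
  have hsq : ∀ c : Fin n → Fin m → F, (∑ A : Finset (Fin n),
      erasureProb ε A * (1 - indepInd F A c) - ∑ A : Finset (Fin n), erasureProb ε A *
        (1 - indepProb (Fintype.card F) (Fintype.card (Fin m → F)) A.card)) ^ 2 =
      ∑ A : Finset (Fin n), ∑ B : Finset (Fin n), erasureProb ε A * erasureProb ε B *
        ((indepInd F A c - indepProb (Fintype.card F) (Fintype.card (Fin m → F)) A.card) *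
        (indepInd F B c - indepProb (Fintype.card F) (Fintype.card (Fin m → F)) B.card)) := by
    intro c
    rw [← Finset.sum_sub_distrib, sq, Finset.sum_mul_sum]
    refine Finset.sum_congr rfl fun A _ => Finset.sum_congr rfl fun B _ => ?_
    ring
  simp_rw [hsq]
  rw [Finset.sum_comm, Finset.sum_mul]
  refine Finset.sum_congr rfl fun A _ => ?_
  rw [Finset.sum_comm, Finset.sum_mul]
  refine Finset.sum_congr rfl fun B _ => ?_
  rw [← Finset.mul_sum, sum_sub_mul_sub_indepInd, hQ]
  unfold indepCov
  ring

end Variance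

/-! ### Weighted sums over pairs of subsets -/

section SubsetSums

variable {n : ℕ}

theorem sum_pow_card_mul_pow_card_inter (A : Finset (Fin n)) (a b q : ℝ) :
    ∑ B : Finset (Fin n), a ^ B.card * b ^ (n - B.card) * q ^ (A ∩ B).card =
      (q * a + b) ^ A.card * (a + b) ^ (n - A.card) := by
  have h := Finset.prod_add (fun i => a * if i ∈ A then q else 1) (fun _ => b)
    (Finset.univ : Finset (Fin n))
  rw [Finset.powerset_univ] at h
  have hr : ∀ B : Finset (Fin n), a ^ B.card * b ^ (n - B.card) * q ^ (A ∩ B).card =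
      (∏ i ∈ B, a * if i ∈ A then q else 1) * ∏ i ∈ Finset.univ \ B, b := by
    intro B
    rw [Finset.prod_mul_distrib, Finset.prod_const, Finset.prod_const,
      ← Finset.compl_eq_univ_sdiff, Finset.card_compl, Fintype.card_fin, Finset.prod_ite_mem,
      Finset.prod_const, Finset.inter_comm]
    ring
  simp_rw [hr]
  rw [← h, ← Finset.prod_mul_prod_compl A]
  have h1 : ∏ i ∈ A, ((a * if i ∈ A then q else 1) + b) = ∏ i ∈ A, (q * a + b) :=
    Finset.prod_congr rfl fun i hi => by simp [hi, mul_comm]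
  have h2 : ∏ i ∈ Aᶜ, ((a * if i ∈ A then q else 1) + b) = ∏ i ∈ Aᶜ, (a + b) :=
    Finset.prod_congr rfl fun i hi => by simp [Finset.mem_compl.1 hi]
  rw [h1, h2, Finset.prod_const, Finset.prod_const, Finset.card_compl, Fintype.card_fin]

/-- The marginal of the pair weight in `A` is again of product form, so the size of `A` is binomial
after normalization. -/
theorem sum_pairWeight (A : Finset (Fin n)) (a b q : ℝ) :
    ∑ B : Finset (Fin n),
      a ^ A.card * b ^ (n - A.card) * (a ^ B.card * b ^ (n - B.card)) * q ^ (A ∩ B).card =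
      (a * (q * a + b)) ^ A.card * (b * (a + b)) ^ (n - A.card) := by
  simp_rw [mul_assoc (a ^ A.card * b ^ (n - A.card))]
  rw [← Finset.mul_sum, sum_pow_card_mul_pow_card_inter, mul_pow, mul_pow]
  ring

theorem sum_sum_pairWeight (a b q : ℝ) :
    ∑ A : Finset (Fin n), ∑ B : Finset (Fin n),
      a ^ A.card * b ^ (n - A.card) * (a ^ B.card * b ^ (n - B.card)) * q ^ (A ∩ B).card =
      (a * (q * a + b) + b * (a + b)) ^ n := by
  simp_rw [sum_pairWeight]
  simpa using Fintype.sum_pow_mul_eq_add_pow (Fin n) (a * (q * a + b)) (b * (a + b))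

theorem sum_pow_card_mul_sq_sub (x y : ℝ) (hxy : x + y ≠ 0) :
    ∑ A : Finset (Fin n),
      x ^ A.card * y ^ (n - A.card) * (A.card - n * (x / (x + y))) ^ 2 =
      (x + y) ^ n * (n * (x / (x + y)) * (1 - x / (x + y))) := by
  -- The Bernstein variance identity, evaluated at the success probability `x / (x + y)`, is the
  -- binomial variance.
  have h := congrArg (Polynomial.eval (x / (x + y))) (bernsteinPolynomial.variance ℝ n)
  simp only [nsmul_eq_mul, bernsteinPolynomial, Polynomial.eval_finsetSum,
    Polynomial.eval_mul, Polynomial.eval_pow, Polynomial.eval_sub, Polynomial.eval_natCast,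
    Polynomial.eval_X, Polynomial.eval_one] at h
  rw [← h, ← Finset.powerset_univ, Finset.sum_powerset_apply_card
    (fun k => x ^ k * y ^ (n - k) * ((k : ℝ) - n * (x / (x + y))) ^ 2), Finset.mul_sum,
    Finset.card_univ, Fintype.card_fin]
  refine Finset.sum_congr rfl fun k hk => ?_
  have hk' : k ≤ n := Nat.lt_succ_iff.1 (Finset.mem_range.1 hk)
  have h1 : 1 - x / (x + y) = y / (x + y) := by field_simp; ring
  have h2 : (x + y) ^ n = (x + y) ^ k * (x + y) ^ (n - k) := by
    rw [← pow_add, Nat.add_sub_cancel' hk']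
  rw [h1, h2, nsmul_eq_mul, div_pow x, div_pow y]
  field_simp
  ring

/-- Chebyshev's inequality for the size of a random subset with independent elements. -/
theorem sum_pow_card_filter_le (x y δ : ℝ) (hx : 0 < x) (hy : 0 < y) (hδ : 0 < δ) (hn : 0 < n)
    (s : Finset (Finset (Fin n)))
    (hs : ∀ A ∈ s, δ * n ≤ |(A.card : ℝ) - n * (x / (x + y))|) :
    ∑ A ∈ s, x ^ A.card * y ^ (n - A.card) ≤ (x + y) ^ n / (n * δ ^ 2) := by
  have hn' : (0 : ℝ) < n := Nat.cast_pos.2 hn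
  rw [le_div_iff₀ (by positivity)]
  have hμ : (x / (x + y)) * (1 - x / (x + y)) ≤ 1 := by
    nlinarith [sq_nonneg (x / (x + y) - 1 / 2)]
  have key : (∑ A ∈ s, x ^ A.card * y ^ (n - A.card)) * (δ * n) ^ 2 ≤ (x + y) ^ n * n := by
    calc (∑ A ∈ s, x ^ A.card * y ^ (n - A.card)) * (δ * n) ^ 2
        ≤ ∑ A ∈ s, x ^ A.card * y ^ (n - A.card) * (A.card - n * (x / (x + y))) ^ 2 := by
          rw [Finset.sum_mul]
          refine Finset.sum_le_sum fun A hA => ?_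
          refine mul_le_mul_of_nonneg_left ?_ (by positivity)
          rw [← sq_abs ((A.card : ℝ) - _)]
          exact pow_le_pow_left₀ (by positivity) (hs A hA) 2
      _ ≤ ∑ A : Finset (Fin n),
            x ^ A.card * y ^ (n - A.card) * (A.card - n * (x / (x + y))) ^ 2 :=
          Finset.sum_le_sum_of_subset_of_nonneg (Finset.subset_univ _)
            fun A _ _ => by positivity
      _ = (x + y) ^ n * (n * (x / (x + y)) * (1 - x / (x + y))) :=
          sum_pow_card_mul_sq_sub x y (by positivity)
      _ ≤ (x + y) ^ n * n := by
          refine mul_le_mul_of_nonneg_left ?_ (by positivity)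
          rw [mul_assoc]
          exact mul_le_of_le_one_right hn'.le hμ
  refine le_of_mul_le_mul_right ?_ hn'
  calc _ = (∑ A ∈ s, x ^ A.card * y ^ (n - A.card)) * (δ * n) ^ 2 := by ring
    _ ≤ _ := key

/-- Restricting the total pair weight to intersecting pairs from a set `s` of subsets loses at most
the weight of the complement of `s`, counted twice, and the weight of the disjoint pairs. -/
theorem le_sum_pairWeight_filter (a b q : ℝ) (ha : 0 < a) (hb : 0 < b) (hq : 0 < q)
    (p : Finset (Fin n) → Prop) [DecidablePred p] :
    (a * (q * a + b) + b * (a + b)) ^ n - (a * b + b * (a + b)) ^ n -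
        2 * ∑ A : Finset (Fin n) with ¬ p A,
          (a * (q * a + b)) ^ A.card * (b * (a + b)) ^ (n - A.card) ≤
      ∑ A : Finset (Fin n), ∑ B : Finset (Fin n),
        if p A ∧ p B ∧ 0 < (A ∩ B).card then
          a ^ A.card * b ^ (n - A.card) * (a ^ B.card * b ^ (n - B.card)) * q ^ (A ∩ B).card
        else 0 := by
  -- At `q = 0` the factor `0 ^ |A ∩ B|` selects exactly the disjoint pairs, since `0 ^ 0 = 1`.
  have h0 := sum_sum_pairWeight (n := n) a b 0
  rw [zero_mul, zero_add] at h0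
  rw [← sum_sum_pairWeight, ← h0]
  have hA : ∑ A : Finset (Fin n) with ¬ p A,
      (a * (q * a + b)) ^ A.card * (b * (a + b)) ^ (n - A.card) =
      ∑ A : Finset (Fin n), ∑ B : Finset (Fin n), if ¬ p A then
        a ^ A.card * b ^ (n - A.card) * (a ^ B.card * b ^ (n - B.card)) * q ^ (A ∩ B).card
        else 0 := by
    rw [Finset.sum_filter]
    refine Finset.sum_congr rfl fun A _ => ?_
    rw [← sum_pairWeight]
    split_ifs <;> simp
  have hB : ∑ A : Finset (Fin n) with ¬ p A,
      (a * (q * a + b)) ^ A.card * (b * (a + b)) ^ (n - A.card) =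
      ∑ A : Finset (Fin n), ∑ B : Finset (Fin n), if ¬ p B then
        a ^ A.card * b ^ (n - A.card) * (a ^ B.card * b ^ (n - B.card)) * q ^ (A ∩ B).card
        else 0 := by
    rw [hA, Finset.sum_comm]
    refine Finset.sum_congr rfl fun A _ => Finset.sum_congr rfl fun B _ => ?_
    rw [Finset.inter_comm]
    split_ifs <;> ring
  rw [two_mul]
  nth_rewrite 1 [hA]
  rw [hB]
  simp only [← Finset.sum_add_distrib, ← Finset.sum_sub_distrib]
  refine Finset.sum_le_sum fun A _ => Finset.sum_le_sum fun B _ => ?_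
  have hw : 0 ≤ a ^ A.card * b ^ (n - A.card) * (a ^ B.card * b ^ (n - B.card)) := by positivity
  rcases Nat.eq_zero_or_pos (A ∩ B).card with hk | hk
  · simp only [hk, pow_zero, mul_one, lt_irrefl, and_false, if_false]
    split_ifs <;> linarith
  · have hq' := mul_nonneg hw (pow_nonneg hq.le (A ∩ B).card)
    simp only [zero_pow hk.ne', mul_zero, sub_zero, hk, and_true]
    by_cases h1 : p A <;> by_cases h2 : p B <;> simp only [h1, h2, not_true, not_false_iff,
      and_self, and_true, and_false, if_true, if_false] <;> linarith

end SubsetSums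

/-! ### Two-sided bounds on the covariance -/

section Covariance

variable {q : ℝ} {m : ℕ}

theorem indepProb_factor_mem (hq : 2 ≤ q) {l : ℕ} (hl : l ≤ m) :
    0 ≤ 1 - q ^ l / q ^ m ∧ 1 - q ^ l / q ^ m ≤ 1 := by
  have h1 : q ^ l / q ^ m ≤ 1 :=
    div_le_one_of_le₀ (pow_le_pow_right₀ (by linarith) hl) (by positivity)
  have h2 : 0 ≤ q ^ l / q ^ m := by positivity
  constructor <;> linarith

theorem indepProb_nonneg (hq : 2 ≤ q) {i : ℕ} (hi : i ≤ m) : 0 ≤ indepProb q (q ^ m) i :=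
  Finset.prod_nonneg fun _ hl =>
    (indepProb_factor_mem hq ((Finset.mem_range.1 hl).le.trans hi)).1

theorem indepProb_le_one (hq : 2 ≤ q) {i : ℕ} (hi : i ≤ m) : indepProb q (q ^ m) i ≤ 1 :=
  Finset.prod_le_one
    (fun _ hl => (indepProb_factor_mem hq ((Finset.mem_range.1 hl).le.trans hi)).1)
    (fun _ hl => (indepProb_factor_mem hq ((Finset.mem_range.1 hl).le.trans hi)).2)

theorem indepProb_eq_zero (hq : 2 ≤ q) {i : ℕ} (hi : m < i) : indepProb q (q ^ m) i = 0 :=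
  Finset.prod_eq_zero (Finset.mem_range.2 hi) (by
    have : q ^ m ≠ 0 := by positivity
    simp [this])

theorem one_sub_le_indepProb (hq : 2 ≤ q) {i : ℕ} (hi : i ≤ m) :
    1 - q ^ i / q ^ m ≤ indepProb q (q ^ m) i := by
  induction i with
  | zero =>
    have : 0 ≤ q ^ 0 / q ^ m := by positivity
    simp only [indepProb, Finset.range_zero, Finset.prod_empty]
    linarith
  | succ i ih =>
    have h := ih (by omega)
    have hf := indepProb_factor_mem hq (show i ≤ m by omega)
    unfold indepProb at h ⊢
    rw [Finset.prod_range_succ]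
    -- With `x = q ^ i / q ^ m`, this gives `(1 - x) ^ 2 ≥ 1 - 2 * x ≥ 1 - q * x`, which closes the
    -- induction.
    have h2 : 2 * (q ^ i / q ^ m) ≤ q ^ (i + 1) / q ^ m := by
      rw [pow_succ, mul_comm (q ^ i) q, mul_div_assoc]
      have : 0 ≤ q ^ i / q ^ m := by positivity
      gcongr
    nlinarith [mul_le_mul_of_nonneg_right h hf.1, sq_nonneg (q ^ i / q ^ m)]

theorem indepProb_le_one_sub (hq : 2 ≤ q) {i : ℕ} (hi : i + 1 ≤ m) :
    indepProb q (q ^ m) (i + 1) ≤ 1 - q ^ i / q ^ m := by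
  have h := indepProb_le_one hq (show i ≤ m by omega)
  have hf := indepProb_factor_mem hq (show i ≤ m by omega)
  unfold indepProb at h ⊢
  rw [Finset.prod_range_succ]
  exact mul_le_of_le_one_left hf.1 h

variable {ι : Type*} [DecidableEq ι]

theorem indepCov_eq_zero (hq : 2 ≤ q) (A B : Finset ι) (h : m < A.card ∨ m < B.card) :
    indepCov q (q ^ m) A B = 0 := by
  unfold indepCov
  by_cases hB : m < B.card
  · rw [indepProb_eq_zero hq hB]
    ring
  · have hA : m < A.card := h.resolve_right hB
    have hk := Finset.card_le_card (Finset.inter_subset_right (s₁ := A) (s₂ := B))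
    rw [Finset.prod_eq_zero (i := m) (Finset.mem_Ico.2 ⟨by omega, hA⟩)]
    · ring
    · have : q ^ m ≠ 0 := by positivity
      simp [this]

theorem prod_Ico_factor_mem (hq : 2 ≤ q) {k i : ℕ} (hk : k ≤ i) (hi : i ≤ m) :
    indepProb q (q ^ m) i ≤ ∏ l ∈ Finset.Ico k i, (1 - q ^ l / q ^ m) ∧
      ∏ l ∈ Finset.Ico k i, (1 - q ^ l / q ^ m) ≤ 1 := by
  have h0 : ∀ l ∈ Finset.Ico k i, 0 ≤ 1 - q ^ l / q ^ m := fun l hl =>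
    (indepProb_factor_mem hq ((Finset.mem_Ico.1 hl).2.le.trans hi)).1
  refine ⟨?_, Finset.prod_le_one h0 fun l hl =>
    (indepProb_factor_mem hq ((Finset.mem_Ico.1 hl).2.le.trans hi)).2⟩
  unfold indepProb
  rw [← Finset.prod_range_mul_prod_Ico _ hk]
  exact mul_le_of_le_one_left (Finset.prod_nonneg h0) (indepProb_le_one hq (hk.trans hi))

theorem indepCov_nonneg (hq : 2 ≤ q) (A B : Finset ι) : 0 ≤ indepCov q (q ^ m) A B := by
  by_cases h : m < A.card ∨ m < B.card
  · rw [indepCov_eq_zero hq A B h]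
  · push Not at h
    have hk := Finset.card_le_card (Finset.inter_subset_left (s₁ := A) (s₂ := B))
    exact mul_nonneg (mul_nonneg ((indepProb_nonneg hq h.1).trans
      (prod_Ico_factor_mem hq hk h.1).1) (indepProb_nonneg hq h.2))
      (sub_nonneg.2 (indepProb_le_one hq (hk.trans h.1)))

theorem indepCov_le (hq : 2 ≤ q) (A B : Finset ι) (hA : A.card ≤ m) (hB : B.card ≤ m) :
    indepCov q (q ^ m) A B ≤ q ^ (A ∩ B).card / q ^ m := by
  have hk := Finset.card_le_card (Finset.inter_subset_left (s₁ := A) (s₂ := B))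
  have h1 := prod_Ico_factor_mem hq hk hA
  have h2 := one_sub_le_indepProb hq (hk.trans hA)
  have h3 := sub_nonneg.2 (indepProb_le_one hq (hk.trans hA))
  unfold indepCov
  refine (mul_le_of_le_one_left h3 ?_).trans (by linarith)
  exact mul_le_one₀ h1.2 (indepProb_nonneg hq hB) (indepProb_le_one hq hB)

theorem half_le_indepProb (hq : 2 ≤ q) {i : ℕ} (hi : i < m) :
    1 / 2 ≤ indepProb q (q ^ m) i := by
  refine le_trans ?_ (one_sub_le_indepProb hq hi.le)
  have h : q ^ i / q ^ m ≤ 1 / 2 := by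
    rw [div_le_div_iff₀ (by positivity) two_pos, one_mul]
    calc q ^ i * 2 ≤ q ^ i * q := by gcongr
      _ = q ^ (i + 1) := (pow_succ _ _).symm
      _ ≤ q ^ m := pow_le_pow_right₀ (by linarith) hi
  linarith

/-- Each of the two independence factors is at least `1 / 2`, for which sizes strictly below `m` are
needed; the last factor is at least `q ^ (|A ∩ B| - 1) / q ^ m`. Disjoint sets have covariance zero
and must be excluded. -/
theorem le_indepCov (hq : 2 ≤ q) (A B : Finset ι) (hA : A.card < m) (hB : B.card < m)
    (hAB : 0 < (A ∩ B).card) :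
    q ^ (A ∩ B).card / (4 * q * q ^ m) ≤ indepCov q (q ^ m) A B := by
  have hk := Finset.card_le_card (Finset.inter_subset_left (s₁ := A) (s₂ := B))
  have h1 := (half_le_indepProb hq hA).trans (prod_Ico_factor_mem hq hk hA.le).1
  have h2 := half_le_indepProb hq hB
  obtain ⟨k, hk'⟩ : ∃ k, (A ∩ B).card = k + 1 := ⟨(A ∩ B).card - 1, by omega⟩
  have h3 := indepProb_le_one_sub hq (show k + 1 ≤ m by omega)
  rw [← hk'] at h3
  have h4 : q ^ (A ∩ B).card / (4 * q * q ^ m) = 1 / 2 * (1 / 2) * (q ^ k / q ^ m) := by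
    rw [hk']
    field_simp
    ring
  rw [h4]
  unfold indepCov
  gcongr
  linarith

end Covariance

/-! ### Chernoff and Chebyshev bounds for the variance -/

section Bounds

variable {F : Type*} [Field F] [Fintype F] {m n : ℕ}

theorem two_le_card : (2 : ℝ) ≤ Fintype.card F := by
  exact_mod_cast Fintype.one_lt_card (α := F)

/-- The tilted total weight per coordinate of pairs of erasure patterns. -/
noncomputable def tiltedMass (q ε t : ℝ) : ℝ :=
  t * ε * (q * (t * ε) + (1 - ε)) + (1 - ε) * (t * ε + (1 - ε))

/-- The probability of an erasure under the tilted measure on pairs of erasure patterns. -/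
noncomputable def tiltedMean (q ε t : ℝ) : ℝ :=
  t * ε * (q * (t * ε) + (1 - ε)) / tiltedMass q ε t

theorem erasureProb_nonneg {ε : ℝ} (hε0 : 0 < ε) (hε1 : ε < 1) (A : Finset (Fin n)) :
    0 ≤ erasureProb ε A := by
  have : 0 < 1 - ε := by linarith
  unfold erasureProb
  positivity

theorem pow_card_mul_erasureProb (ε t : ℝ) (A : Finset (Fin n)) :
    t ^ A.card * erasureProb ε A = (t * ε) ^ A.card * (1 - ε) ^ (n - A.card) := by
  rw [erasureProb, mul_pow, mul_assoc]

/-- Pairs with a set larger than `m` contribute nothing, and on the others `t ^ (2 * m) ≤ t ^ (|A| +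
|B|)` because `t ≤ 1`. -/
theorem varianceUd_le {ε t : ℝ} (hε0 : 0 < ε) (hε1 : ε < 1) (ht0 : 0 < t) (ht1 : t ≤ 1) :
    t ^ (2 * m) * (Fintype.card F : ℝ) ^ m * varianceUd F m n ε ≤
      tiltedMass (Fintype.card F) ε t ^ n := by
  have hq := two_le_card (F := F)
  set q : ℝ := (Fintype.card F : ℝ)
  have hb : 0 < 1 - ε := by linarith
  unfold tiltedMass
  rw [varianceUd_eq_sum, ← sum_sum_pairWeight, Finset.mul_sum]
  refine Finset.sum_le_sum fun A _ => ?_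
  rw [Finset.mul_sum]
  refine Finset.sum_le_sum fun B _ => ?_
  rw [← pow_card_mul_erasureProb, ← pow_card_mul_erasureProb]
  have hA := erasureProb_nonneg hε0 hε1 A
  have hB := erasureProb_nonneg hε0 hε1 B
  by_cases h : m < A.card ∨ m < B.card
  · rw [indepCov_eq_zero hq A B h, mul_zero, mul_zero]
    positivity
  · push Not at h
    have hc := indepCov_le hq A B h.1 h.2
    rw [le_div_iff₀ (by positivity)] at hc
    have ht : t ^ (2 * m) ≤ t ^ (A.card + B.card) :=
      pow_le_pow_of_le_one ht0.le ht1 (by omega)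
    calc t ^ (2 * m) * q ^ m * (erasureProb ε A * erasureProb ε B * indepCov q (q ^ m) A B)
        = t ^ (2 * m) * (erasureProb ε A * erasureProb ε B *
            (indepCov q (q ^ m) A B * q ^ m)) := by ring
      _ ≤ t ^ (A.card + B.card) * (erasureProb ε A * erasureProb ε B * q ^ (A ∩ B).card) := by
          have := indepCov_nonneg (m := m) hq A B
          gcongr
      _ = _ := by rw [pow_add]; ring

/-- Under the tilted pair measure both sizes concentrate at `tiltedMean * n`, hence lie in `[l, m)`,
where `t ^ (|A| + |B|) ≤ t ^ (2 * l)`. The subtracted terms are the disjoint pairs and the Chebyshev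
tails of `A` and of `B`. -/
theorem le_varianceUd {ε t δ : ℝ} (hε0 : 0 < ε) (hε1 : ε < 1) (ht0 : 0 < t) (ht1 : t ≤ 1)
    (hδ : 0 < δ) (hn : 0 < n) (hm : (tiltedMean (Fintype.card F) ε t + δ) * n ≤ m) {l : ℕ}
    (hl : (l : ℝ) ≤ (tiltedMean (Fintype.card F) ε t - δ) * n) :
    tiltedMass (Fintype.card F) ε t ^ n - tiltedMass 0 ε t ^ n -
        2 * (tiltedMass (Fintype.card F) ε t ^ n / (n * δ ^ 2)) ≤
      t ^ (2 * l) * (4 * Fintype.card F * (Fintype.card F : ℝ) ^ m) * varianceUd F m n ε := by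
  classical
  have hq := two_le_card (F := F)
  set q : ℝ := (Fintype.card F : ℝ)
  have hb : 0 < 1 - ε := by linarith
  have hx : 0 < t * ε * (q * (t * ε) + (1 - ε)) := by positivity
  have hy : 0 < (1 - ε) * (t * ε + (1 - ε)) := by positivity
  have hcheb := sum_pow_card_filter_le _ _ δ hx hy hδ hn
    (Finset.univ.filter fun A : Finset (Fin n) => ¬ (l ≤ A.card ∧ A.card < m)) (by
      intro A hA
      rw [Finset.mem_filter] at hA
      unfold tiltedMean tiltedMass at hm hl
      rw [le_abs]
      by_cases hlA : l ≤ A.card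
      · left
        have hmA : (m : ℝ) ≤ A.card := by exact_mod_cast not_lt.1 fun h => hA.2 ⟨hlA, h⟩
        linarith
      · right
        have hlA' : (A.card : ℝ) ≤ l := by exact_mod_cast (not_le.1 hlA).le
        linarith)
  have hmain := le_sum_pairWeight_filter (t * ε) (1 - ε) q (by positivity) hb (by positivity)
    (fun A : Finset (Fin n) => l ≤ A.card ∧ A.card < m)
  have hupper : (∑ A : Finset (Fin n), ∑ B : Finset (Fin n),
      if (l ≤ A.card ∧ A.card < m) ∧ (l ≤ B.card ∧ B.card < m) ∧ 0 < (A ∩ B).card then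
        (t * ε) ^ A.card * (1 - ε) ^ (n - A.card) *
          ((t * ε) ^ B.card * (1 - ε) ^ (n - B.card)) * q ^ (A ∩ B).card
      else 0) ≤ t ^ (2 * l) * (4 * q * q ^ m) * varianceUd F m n ε := by
    rw [varianceUd_eq_sum, Finset.mul_sum]
    refine Finset.sum_le_sum fun A _ => ?_
    rw [Finset.mul_sum]
    refine Finset.sum_le_sum fun B _ => ?_
    rw [← pow_card_mul_erasureProb, ← pow_card_mul_erasureProb]
    have hA := erasureProb_nonneg hε0 hε1 A
    have hB := erasureProb_nonneg hε0 hε1 B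
    split_ifs with h
    · have hc := le_indepCov hq A B h.1.2 h.2.1.2 h.2.2
      rw [div_le_iff₀ (by positivity)] at hc
      have ht : t ^ (A.card + B.card) ≤ t ^ (2 * l) :=
        pow_le_pow_of_le_one ht0.le ht1 (by omega)
      calc t ^ A.card * erasureProb ε A * (t ^ B.card * erasureProb ε B) * q ^ (A ∩ B).card
          = t ^ (A.card + B.card) * (erasureProb ε A * erasureProb ε B * q ^ (A ∩ B).card) := by
            rw [pow_add]; ring
        _ ≤ t ^ (2 * l) * (erasureProb ε A * erasureProb ε B *
              (indepCov q (q ^ m) A B * (4 * q * q ^ m))) := by gcongr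
        _ = _ := by ring
    · have := indepCov_nonneg (m := m) hq A B
      positivity
  unfold tiltedMass
  rw [zero_mul, zero_add]
  linarith

end Bounds

open Filter Topology

/-! ### Monotonicity and continuity in the tilt -/

section Tilting

variable {q ε : ℝ}

theorem tiltedMass_pos (hq : 0 ≤ q) (hε0 : 0 < ε) (hε1 : ε < 1) {t : ℝ} (ht : 0 < t) :
    0 < tiltedMass q ε t := by
  have : 0 < 1 - ε := by linarith
  unfold tiltedMass
  positivity

theorem tiltedMass_zero_lt (hq : 0 < q) (hε0 : 0 < ε) {t : ℝ} (ht : 0 < t) :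
    tiltedMass 0 ε t < tiltedMass q ε t := by
  have : 0 < t * ε * (q * (t * ε)) := by positivity
  unfold tiltedMass
  linarith

theorem tiltedMean_pos (hq : 0 ≤ q) (hε0 : 0 < ε) (hε1 : ε < 1) {t : ℝ} (ht : 0 < t) :
    0 < tiltedMean q ε t := by
  have : 0 < 1 - ε := by linarith
  have := tiltedMass_pos hq hε0 hε1 ht
  unfold tiltedMean
  positivity

theorem tiltedMean_lt (hq : 0 ≤ q) (hε0 : 0 < ε) (hε1 : ε < 1) {s t : ℝ} (hs : 0 < s)
    (hst : s < t) : tiltedMean q ε s < tiltedMean q ε t := by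
  have hb : 0 < 1 - ε := by linarith
  have h1 := tiltedMass_pos hq hε0 hε1 hs
  have h2 := tiltedMass_pos hq hε0 hε1 (hs.trans hst)
  unfold tiltedMean
  rw [div_lt_div_iff₀ h1 h2]
  unfold tiltedMass
  have ht : 0 < t := hs.trans hst
  -- This is the factored difference of the two cross-multiplied sides.
  have key : 0 < (t - s) * (ε * (1 - ε) *
      (q * ε * (1 - ε) * (s + t) + (1 - ε) ^ 2 + q * ε ^ 2 * s * t)) :=
    mul_pos (sub_pos.2 hst) (by positivity)
  linarith

theorem continuousAt_tiltedMass (t : ℝ) : ContinuousAt (tiltedMass q ε) t := by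
  unfold tiltedMass
  fun_prop

theorem continuousAt_tiltedMean (hq : 0 ≤ q) (hε0 : 0 < ε) (hε1 : ε < 1) {t : ℝ} (ht : 0 < t) :
    ContinuousAt (tiltedMean q ε) t := by
  unfold tiltedMean
  exact ContinuousAt.div (by fun_prop) (continuousAt_tiltedMass t)
    (tiltedMass_pos hq hε0 hε1 ht).ne'

/-- The exponent of the variance at the optimal tilt can be approximated by tilts whose mean
erasure rate is strictly below the threshold `1 - R`. -/
theorem exists_tilt_lt (hq : 0 ≤ q) (hε0 : 0 < ε) (hε1 : ε < 1) {R t : ℝ} (ht0 : 0 < t)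
    (ht1 : t ≤ 1) (hmean : tiltedMean q ε t ≤ 1 - R)
    (hopt : t = 1 ∨ tiltedMean q ε t = 1 - R) {s : ℝ}
    (hs : s < Real.log (tiltedMass q ε t) - 2 * (1 - R) * Real.log t -
      (1 - R) * Real.log q) :
    ∃ t' δ : ℝ, 0 < t' ∧ t' ≤ 1 ∧ 0 < δ ∧ δ < tiltedMean q ε t' ∧
      tiltedMean q ε t' + δ < 1 - R ∧
      s < Real.log (tiltedMass q ε t') - 2 * (tiltedMean q ε t' - δ) * Real.log t' -
        (1 - R) * Real.log q := by
  have hcont : ContinuousAt (fun u => Real.log (tiltedMass q ε u) -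
      2 * tiltedMean q ε u * Real.log u - (1 - R) * Real.log q) t :=
    (((continuousAt_tiltedMass t).log (tiltedMass_pos hq hε0 hε1 ht0).ne').sub
      ((continuousAt_const.mul (continuousAt_tiltedMean hq hε0 hε1 ht0)).mul
        (Real.continuousAt_log ht0.ne'))).sub continuousAt_const
  -- Replacing `1 - R` by the tilted mean in front of `log t` changes nothing: either `log t = 0` or
  -- the two agree.
  have hs' : s < Real.log (tiltedMass q ε t) - 2 * tiltedMean q ε t * Real.log t -
      (1 - R) * Real.log q := by
    rcases hopt with rfl | h
    · simpa using hs
    · rwa [h]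
  -- Moving the tilt slightly to the left makes the mean strictly smaller than `1 - R`, leaving room
  -- for `δ`.
  have hev := (hcont.eventually_const_lt hs').filter_mono (nhdsWithin_le_nhds (s := Set.Iio t))
  obtain ⟨u, hu, hu0, hut⟩ := (hev.and (((lt_mem_nhds ht0).filter_mono
    (nhdsWithin_le_nhds (s := Set.Iio t))).and self_mem_nhdsWithin)).exists
  have hut' : u < t := hut
  have hlt := (tiltedMean_lt hq hε0 hε1 hu0 hut').trans_le hmean
  have hcont2 : ContinuousAt (fun δ => Real.log (tiltedMass q ε u) -
      2 * (tiltedMean q ε u - δ) * Real.log u - (1 - R) * Real.log q) 0 := by fun_prop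
  have hev2 := (hcont2.eventually_const_lt (by simpa using hu)).filter_mono
    (nhdsWithin_le_nhds (s := Set.Ioi (0 : ℝ)))
  obtain ⟨δ, hδ, ⟨hδ1, hδ2⟩, hδ0⟩ := (hev2.and ((((gt_mem_nhds
    (tiltedMean_pos hq hε0 hε1 hu0)).and (gt_mem_nhds (sub_pos.2 hlt))).filter_mono
    (nhdsWithin_le_nhds (s := Set.Ioi (0 : ℝ)))).and self_mem_nhdsWithin)).exists
  exact ⟨u, δ, hu0, hut'.le.trans ht1, hδ0, hδ1, by linarith, hδ⟩

end Tilting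

/-! ### The limit of the normalized logarithm -/

section Limit

variable {F : Type*} [Field F] [Fintype F] {ε R : ℝ} {m : ℕ → ℕ}

theorem tendsto_div_of_abs_sub_lt {c : ℝ} (hm : ∀ n : ℕ, |(m n : ℝ) - c * n| < 1) :
    Tendsto (fun n : ℕ => (m n : ℝ) / n) atTop (𝓝 c) := by
  rw [tendsto_iff_dist_tendsto_zero]
  refine squeeze_zero' (Eventually.of_forall fun _ => dist_nonneg) ?_
    tendsto_one_div_atTop_nhds_zero_nat
  filter_upwards [eventually_gt_atTop 0] with n hn
  have hn' : (0 : ℝ) < n := Nat.cast_pos.2 hn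
  rw [Real.dist_eq, show (m n : ℝ) / n - c = (m n - c * n) / n by field_simp, abs_div,
    abs_of_pos hn']
  exact div_le_div_of_nonneg_right (hm n).le hn'.le

theorem eventually_pos_and_le_log_varianceUd (hε0 : 0 < ε) (hε1 : ε < 1)
    (hm : Tendsto (fun n : ℕ => (m n : ℝ) / n) atTop (𝓝 (1 - R))) {t δ : ℝ} (ht0 : 0 < t)
    (ht1 : t ≤ 1) (hδ0 : 0 < δ) (hδ : δ < tiltedMean (Fintype.card F) ε t)
    (hR : tiltedMean (Fintype.card F) ε t + δ < 1 - R) {s : ℝ}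
    (hs : s < Real.log (tiltedMass (Fintype.card F) ε t) -
      2 * (tiltedMean (Fintype.card F) ε t - δ) * Real.log t -
        (1 - R) * Real.log (Fintype.card F)) :
    ∀ᶠ n : ℕ in atTop, 0 < varianceUd F (m n) n ε ∧
      s < Real.log (varianceUd F (m n) n ε) / n := by
  have hq := two_le_card (F := F)
  set q : ℝ := (Fintype.card F : ℝ)
  set Z := tiltedMass q ε t
  set μ := tiltedMean q ε t
  have hZ : 0 < Z := tiltedMass_pos (by linarith) hε0 hε1 ht0
  have hZ0 : 0 < tiltedMass 0 ε t := tiltedMass_pos le_rfl hε0 hε1 ht0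
  have hr : Tendsto (fun n : ℕ => (tiltedMass 0 ε t / Z) ^ n) atTop (𝓝 0) :=
    tendsto_pow_atTop_nhds_zero_of_lt_one (by positivity)
      ((div_lt_one hZ).2 (tiltedMass_zero_lt (by linarith) hε0 ht0))
  have hl : Tendsto (fun n : ℕ => (⌊(μ - δ) * n⌋₊ : ℝ) / n) atTop (𝓝 (μ - δ)) :=
    (tendsto_nat_floor_mul_div_atTop (sub_pos.2 hδ).le).comp tendsto_natCast_atTop_atTop
  have hlim : Tendsto (fun n : ℕ => Real.log Z - 2 * ((⌊(μ - δ) * n⌋₊ : ℝ) / n) * Real.log t -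
      (m n : ℝ) / n * Real.log q - Real.log (8 * q) / n) atTop
      (𝓝 (Real.log Z - 2 * (μ - δ) * Real.log t - (1 - R) * Real.log q - 0)) :=
    ((tendsto_const_nhds.sub ((hl.const_mul 2).mul_const _)).sub (hm.mul_const _)).sub
      (tendsto_const_div_atTop_nhds_zero_nat _)
  rw [sub_zero] at hlim
  -- Disjoint pairs and Chebyshev tails each take at most a quarter of `Z ^ n`; the remaining half
  -- turns the constant `4 * q` into `8 * q`.
  filter_upwards [hlim.eventually_const_lt hs, hm.eventually_const_lt hR,
    hr.eventually_lt_const (show (0 : ℝ) < 1 / 4 by norm_num), eventually_gt_atTop 0,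
    (tendsto_const_div_atTop_nhds_zero_nat (2 / δ ^ 2)).eventually_lt_const
      (show (0 : ℝ) < 1 / 4 by norm_num)] with n h1 h2 h3 hn h4
  have hn' : (0 : ℝ) < n := Nat.cast_pos.2 hn
  have hmain := le_varianceUd (F := F) (m := m n) (l := ⌊(μ - δ) * n⌋₊) hε0 hε1 ht0 ht1 hδ0 hn
    ((lt_div_iff₀ hn').1 h2).le (Nat.floor_le (mul_nonneg (sub_pos.2 hδ).le hn'.le))
  have hZn : 0 < Z ^ n := pow_pos hZ n
  rw [div_pow, div_lt_iff₀ hZn] at h3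
  have h5 : 2 * (Z ^ n / (n * δ ^ 2)) ≤ 1 / 4 * Z ^ n := by
    calc 2 * (Z ^ n / (n * δ ^ 2)) = 2 / δ ^ 2 / n * Z ^ n := by field_simp
      _ ≤ _ := by gcongr
  have h6 : Z ^ n / 2 ≤ t ^ (2 * ⌊(μ - δ) * n⌋₊) * (4 * q * q ^ m n) *
      varianceUd F (m n) n ε := by
    refine le_trans ?_ hmain
    change Z ^ n / 2 ≤ Z ^ n - tiltedMass 0 ε t ^ n - 2 * (Z ^ n / (n * δ ^ 2))
    linarith
  have hV : 0 < varianceUd F (m n) n ε :=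
    pos_of_mul_pos_right ((half_pos hZn).trans_le h6) (by positivity)
  refine ⟨hV, h1.trans_le ?_⟩
  have h7 : Z ^ n ≤ t ^ (2 * ⌊(μ - δ) * n⌋₊) * (8 * q * q ^ m n) *
      varianceUd F (m n) n ε := by linarith
  have h8 := Real.log_le_log hZn h7
  rw [Real.log_mul (by positivity) hV.ne', Real.log_mul (by positivity) (by positivity),
    Real.log_mul (by positivity) (by positivity), Real.log_pow, Real.log_pow, Real.log_pow] at h8
  rw [le_div_iff₀ hn']
  push_cast at h8
  calc _ = n * Real.log Z - 2 * (⌊(μ - δ) * n⌋₊ : ℝ) * Real.log t -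
      (m n : ℝ) * Real.log q - Real.log (8 * q) := by field_simp
    _ ≤ _ := by linarith

theorem log_varianceUd_div_le (hε0 : 0 < ε) (hε1 : ε < 1) {m n : ℕ} (hn : 0 < n)
    (hV : 0 < varianceUd F m n ε) {t : ℝ} (ht0 : 0 < t) (ht1 : t ≤ 1) :
    Real.log (varianceUd F m n ε) / n ≤ Real.log (tiltedMass (Fintype.card F) ε t) -
      2 * ((m : ℝ) / n) * Real.log t - (m : ℝ) / n * Real.log (Fintype.card F) := by
  have hq := two_le_card (F := F)
  have hn' : (0 : ℝ) < n := Nat.cast_pos.2 hn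
  have h := Real.log_le_log (by positivity) (varianceUd_le (F := F) (m := m) (n := n)
    hε0 hε1 ht0 ht1)
  rw [Real.log_mul (by positivity) hV.ne', Real.log_mul (by positivity) (by positivity),
    Real.log_pow, Real.log_pow, Real.log_pow] at h
  push_cast at h
  rw [div_le_iff₀ hn']
  calc _ ≤ n * Real.log (tiltedMass (Fintype.card F) ε t) - 2 * m * Real.log t -
        m * Real.log (Fintype.card F) := by linarith
    _ = _ := by field_simp

theorem eventually_pos_and_tendsto_log_varianceUd (hε0 : 0 < ε) (hε1 : ε < 1)
    (hm : Tendsto (fun n : ℕ => (m n : ℝ) / n) atTop (𝓝 (1 - R))) {t : ℝ} (ht0 : 0 < t)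
    (ht1 : t ≤ 1) (hmean : tiltedMean (Fintype.card F) ε t ≤ 1 - R)
    (hopt : t = 1 ∨ tiltedMean (Fintype.card F) ε t = 1 - R) :
    (∀ᶠ n : ℕ in atTop, 0 < varianceUd F (m n) n ε) ∧
    Tendsto (fun n : ℕ => Real.log (varianceUd F (m n) n ε) / n) atTop
      (𝓝 (Real.log (tiltedMass (Fintype.card F) ε t) - 2 * (1 - R) * Real.log t -
        (1 - R) * Real.log (Fintype.card F))) := by
  have hq : (0 : ℝ) ≤ Fintype.card F := Nat.cast_nonneg _
  have hlower : ∀ s < Real.log (tiltedMass (Fintype.card F) ε t) - 2 * (1 - R) * Real.log t -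
        (1 - R) * Real.log (Fintype.card F),
      ∀ᶠ n : ℕ in atTop, 0 < varianceUd F (m n) n ε ∧
        s < Real.log (varianceUd F (m n) n ε) / n := fun s hs => by
    obtain ⟨u, δ, hu0, hu1, hδ0, hδ1, hδ2, hu⟩ :=
      exists_tilt_lt hq hε0 hε1 ht0 ht1 hmean hopt hs
    exact eventually_pos_and_le_log_varianceUd hε0 hε1 hm hu0 hu1 hδ0 hδ1 hδ2 hu
  have hpos := (hlower _ (sub_one_lt _)).mono fun n hn => hn.1
  refine ⟨hpos, tendsto_order.2 ⟨fun s hs => (hlower s hs).mono fun n hn => hn.2,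
    fun s hs => ?_⟩⟩
  have hlim : Tendsto (fun n : ℕ => Real.log (tiltedMass (Fintype.card F) ε t) -
      2 * ((m n : ℝ) / n) * Real.log t - (m n : ℝ) / n * Real.log (Fintype.card F)) atTop
      (𝓝 (Real.log (tiltedMass (Fintype.card F) ε t) - 2 * (1 - R) * Real.log t -
        (1 - R) * Real.log (Fintype.card F))) :=
    (tendsto_const_nhds.sub ((hm.const_mul 2).mul_const _)).sub (hm.mul_const _)
  filter_upwards [hlim.eventually_lt_const hs, hpos, eventually_gt_atTop 0] with n h1 h2 hn
  exact (log_varianceUd_div_le hε0 hε1 hn h2 ht0 ht1).trans_lt h1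

end Limit

/-! ### The optimal tilt in closed form -/

section Optimum

variable {q ε R : ℝ}

theorem tiltedMass_one : tiltedMass q ε 1 = 1 + (q - 1) * ε ^ 2 := by
  unfold tiltedMass
  ring

theorem tiltedMean_one_le_iff (hq : 2 ≤ q) (hε0 : 0 < ε) (hε1 : ε < 1) :
    tiltedMean q ε 1 ≤ 1 - R ↔ R ≤ (1 - ε) / (1 + (q - 1) * ε ^ 2) := by
  have h := tiltedMass_pos (by linarith : 0 ≤ q) hε0 hε1 one_pos
  unfold tiltedMean
  rw [tiltedMass_one] at h ⊢
  rw [div_le_iff₀ h, le_div_iff₀ h]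
  constructor <;> intro h' <;> linarith

/-- Here `d` is the positive root of `(q - 1) * d ^ 2 + d = R * (1 - R)`. At the optimal tilt, a
position lies in both patterns with probability `1 - R - d = κ₀`, in only the first (or only the
second) with probability `d`, and in neither with probability `R - d`. -/
theorem kappaZero_spec (hq : 2 ≤ q) (hR0 : 0 < R) (hR1 : R < 1) :
    ∃ d : ℝ, 0 < d ∧ d < R ∧ d < 1 - R ∧ kappaZero q R = 1 - R - d ∧
      (1 - R - d) * (R - d) = q * d ^ 2 := by
  have hR : 0 < R * (1 - R) := mul_pos hR0 (by linarith)
  have hq1 : 0 < q - 1 := by linarith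
  have hp : 0 < 4 * R * (1 - R) * (q - 1) := by
    have := mul_pos hR hq1
    linarith
  have hs := Real.sq_sqrt (show 0 ≤ 4 * R * (1 - R) * (q - 1) + 1 by linarith)
  have hs1 : 1 < √(4 * R * (1 - R) * (q - 1) + 1) := by
    rw [Real.lt_sqrt zero_le_one]
    linarith
  set s := √(4 * R * (1 - R) * (q - 1) + 1)
  have hd0 : 0 < (s - 1) / (2 * (q - 1)) := div_pos (by linarith) (by linarith)
  have hsd : s = 2 * (q - 1) * ((s - 1) / (2 * (q - 1))) + 1 := by
    field_simp
    ring
  have heq : (q - 1) * ((s - 1) / (2 * (q - 1))) ^ 2 + (s - 1) / (2 * (q - 1)) =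
      R * (1 - R) := by
    generalize (s - 1) / (2 * (q - 1)) = d at *
    rw [hsd] at hs
    refine mul_left_cancel₀ (show 4 * (q - 1) ≠ 0 by positivity) ?_
    linarith
  refine ⟨(s - 1) / (2 * (q - 1)), hd0, ?_, ?_, rfl, ?_⟩ <;>
  generalize (s - 1) / (2 * (q - 1)) = d at * <;>
  have := mul_pos hq1 (pow_pos hd0 2) <;>
  nlinarith

theorem exists_optimal_tilt (hq : 2 ≤ q) (hε0 : 0 < ε) (hε1 : ε < 1) (hR0 : 0 < R)
    (hR1 : R < 1) :
    ∃ t : ℝ, 0 < t ∧ tiltedMean q ε t = 1 - R ∧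
      Real.log (tiltedMass q ε t) - 2 * (1 - R) * Real.log t - (1 - R) * Real.log q =
        -((1 - R) * Real.log (kappaZero q R / ε ^ 2) +
            R * Real.log ((2 * R - 1 + kappaZero q R) / (1 - ε) ^ 2)) := by
  obtain ⟨d, hd0, hdR, hdR', hκ, hd⟩ := kappaZero_spec hq hR0 hR1
  have hb : 0 < 1 - ε := by linarith
  have hw : 0 < R - d := by linarith
  have hk : 0 < 1 - R - d := by linarith
  have hq0 : 0 < q := by linarith
  -- The tilt solves `t * ε / (1 - ε) = d / (R - d)`, the ratio of the weights for "only one" and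
  -- "neither".
  have hZ : tiltedMass q ε ((1 - ε) * d / (ε * (R - d))) = (1 - ε) ^ 2 / (R - d) := by
    unfold tiltedMass
    field_simp
    linarith
  refine ⟨(1 - ε) * d / (ε * (R - d)), by positivity, ?_, ?_⟩
  · unfold tiltedMean
    rw [hZ]
    field_simp
    linarith
  · rw [hZ, hκ, show 2 * R - 1 + (1 - R - d) = R - d by ring]
    have hlog := congrArg Real.log hd
    rw [Real.log_mul hk.ne' hw.ne', Real.log_mul hq0.ne' (by positivity), Real.log_pow] at hlog
    rw [Real.log_div (by positivity) hw.ne', Real.log_div (by positivity) (by positivity),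
      Real.log_div hk.ne' (by positivity), Real.log_div hw.ne' (by positivity),
      Real.log_mul hb.ne' hd0.ne', Real.log_mul hε0.ne' hw.ne', Real.log_pow, Real.log_pow]
    push_cast at hlog ⊢
    linear_combination (1 - R) * hlog

end Optimum

end ErasureChannel

/-! ### The two regimes -/

open ErasureChannel in
theorem mainTheorem4 {F : Type*} [Field F] [Fintype F] (q : ℝ) (hq : q = Fintype.card F)
    (ε R : ℝ) (hε0 : 0 < ε) (hε1 : ε < 1) (hR0 : 0 < R) (hR1 : R < 1)
    (m : ℕ → ℕ) (hm : ∀ n : ℕ, |(m n : ℝ) - (1 - R) * n| < 1) :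
    (∀ᶠ n : ℕ in Filter.atTop, 0 < varianceUd F (m n) n ε) ∧
    Filter.Tendsto
      (fun n : ℕ => -(1 / (n : ℝ) * Real.logb q (varianceUd F (m n) n ε)))
      Filter.atTop
      (nhds
        (if R ≤ (1 - ε) / (1 + (q - 1) * ε ^ 2) then
          1 - R - Real.logb q (1 + (q - 1) * ε ^ 2)
        else
          (1 - R) * Real.logb q (kappaZero q R / ε ^ 2) +
            R * Real.logb q ((2 * R - 1 + kappaZero q R) / (1 - ε) ^ 2))) := by
  have hq2 : 2 ≤ q := hq ▸ two_le_card
  have hlogq : Real.log q ≠ 0 := (Real.log_pos (by linarith)).ne'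
  have hlim := tendsto_div_of_abs_sub_lt hm
  have hfun : (fun n : ℕ => -(1 / (n : ℝ) * Real.logb q (varianceUd F (m n) n ε))) =
      fun n : ℕ => -(Real.log (varianceUd F (m n) n ε) / n / Real.log q) := by
    ext n
    rw [Real.logb]
    ring
  rw [hfun]
  split_ifs with hR
  · have h1 := (tiltedMean_one_le_iff hq2 hε0 hε1).2 hR
    obtain ⟨hpos, ht⟩ := eventually_pos_and_tendsto_log_varianceUd (F := F) hε0 hε1 hlim
      one_pos le_rfl (hq ▸ h1) (Or.inl rfl)
    refine ⟨hpos, ?_⟩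
    rw [← hq, tiltedMass_one, Real.log_one] at ht
    convert! (ht.div_const (Real.log q)).neg using 2
    rw [Real.logb]
    field_simp
    ring
  · obtain ⟨t, ht0, hmean, hval⟩ := exists_optimal_tilt hq2 hε0 hε1 hR0 hR1
    -- If `t > 1`, monotonicity would put the untilted mean below `1 - R`, which is the first
    -- regime.
    have ht1 : t ≤ 1 := by
      by_contra! h
      exact hR ((tiltedMean_one_le_iff hq2 hε0 hε1).1
        ((tiltedMean_lt (by linarith) hε0 hε1 one_pos h).le.trans hmean.le))
    obtain ⟨hpos, ht⟩ := eventually_pos_and_tendsto_log_varianceUd (F := F) hε0 hε1 hlim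
      ht0 ht1 (hq ▸ hmean.le) (Or.inr (hq ▸ hmean))
    refine ⟨hpos, ?_⟩
    rw [← hq, hval] at ht
    convert! (ht.div_const (Real.log q)).neg using 2
    rw [Real.logb, Real.logb]
    field_simp
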